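/- Let $r\ge 2$ and $k,m,n\ge 0$ be integers, and let $D^m$ be the open unit disc in $\mathbb R^m$. Give the set $C^\infty(\coprod_k D^m,\mathbb R^n)$ of smooth maps the compact-open $C^\infty$-topology (uniform convergence of all partial derivatives on compact subsets). Let $\operatorname{Imm}(\coprod_k D^m,\mathbb R^n)$ be the subspace of immersions, and let $\operatorname{rImm}(\coprod_k D^m,\mathbb R^n)$ be the subspace of $r$-immersions, i.e. immersions for which the preimage of every point of $\mathbb R^n$ has fewer than $r$ points. Let $$\operatorname{rConf}(k,\mathbb R^n)=\{(x_1,\dots,x_k)\in(\mathbb R^n)^k : \text{there are no } 1\le i_1<\dots<i_r\le k \text{ with } x_{i_1}=\dots=x_{i_r}\}.$$ Choose any basepoint $b\in\operatorname{Imm}(\coprod_k D^m,\mathbb R^n)$, and let $\overline{\operatorname{rImm}}(\coprod_k D^m,\mathbb R^n)$ be the homotopy fiber over $b$ of the inclusion $\operatorname{rImm}(\coprod_k D^m,\mathbb R^n)\to\operatorname{Imm}(\coprod_k D^m,\mathbb R^n)$, i.e. the space of pairs $(f,\gamma)$ consisting of an $r$-immersion $f$ and a path $\gamma$ in $\operatorname{Imm}(\coprod_k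 D^m,\mathbb R^n)$ from $f$ to $b$. Then the composite $$\overline{\operatorname{rImm}}\Big(\coprod_k D^m,\mathbb R^n\Big)\to\operatorname{rImm}\Big(\coprod_k D^m,\mathbb R^n\Big)\to\operatorname{rConf}(k,\mathbb R^n)$$ of the canonical map $(f,\gamma)\mapsto f$ with evaluation at the centers of the discs is a weak homotopy equivalence; that is, $\overline{\operatorname{rImm}}(\coprod_k D^m,\mathbb R^n)\simeq\operatorname{rConf}(k,\mathbb R^n)$. -/

import Mathlib

open scoped ContDiff unitInterval Topology

noncomputable section

namespace RImmersion

/-! ### Weak homotopy equivalences and homotopy fibres -/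

section Homotopy

variable {X Y : Type*} [TopologicalSpace X] [TopologicalSpace Y]

/-- The map induced by a continuous map on sets of path components. -/
def pi0Map (f : C(X, Y)) : ZerothHomotopy X → ZerothHomotopy Y :=
  Quotient.map f fun _ _ h => h.map f.continuous

/-- Composition of a generalized loop with a continuous map. -/
def genLoopMap (N : Type*) (f : C(X, Y)) (x : X) (p : GenLoop N X x) : GenLoop N Y (f x) :=
  ⟨f.comp p.1, fun y hy => congrArg f (p.2 y hy)⟩

/-- The map induced by a continuous map `f` on the `d`-th homotopy groups, with base points
`x` and `f x`. -/
def piMap (d : ℕ) (f : C(X, Y)) (x : X) : π_ d X x → π_ d Y (f x) :=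
  Quotient.map (genLoopMap (Fin d) f x) fun _ _ h => h.comp_continuousMap f

/-- A continuous map is a weak homotopy equivalence if it induces a bijection on path components
and, for every base point, bijections on all homotopy groups of positive degree. -/
def IsWeakHomotopyEquiv (f : C(X, Y)) : Prop :=
  Function.Bijective (pi0Map f) ∧
    ∀ (d : ℕ), 1 ≤ d → ∀ x : X, Function.Bijective (piMap d f x)

/-- The homotopy fibre of `p : X → Y` over `b`: pairs of a point `x` and a path in `Y` from `p x`
to `b`, as a subspace of `X × C(I, Y)` with the compact-open topology on paths. -/
def HomotopyFiber (p : C(X, Y)) (b : Y) : Type _ :=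
  {z : X × C(I, Y) // z.2 0 = p z.1 ∧ z.2 1 = b}

instance (p : C(X, Y)) (b : Y) : TopologicalSpace (HomotopyFiber p b) :=
  inferInstanceAs (TopologicalSpace {z : X × C(I, Y) // z.2 0 = p z.1 ∧ z.2 1 = b})

/-- The canonical map from the homotopy fibre of `p : X → Y` to `X`. -/
def HomotopyFiber.proj (p : C(X, Y)) (b : Y) : C(HomotopyFiber p b, X) where
  toFun z := z.1.1
  continuous_toFun := continuous_fst.comp continuous_subtype_val

end Homotopy

/-! ### Smooth maps from a disjoint union of open discs to Euclidean space -/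

/-- The Euclidean space `ℝᵐ`. -/
abbrev E (m : ℕ) : Type := EuclideanSpace ℝ (Fin m)

/-- The open unit disc `Dᵐ` in `ℝᵐ`. -/
abbrev Disc (m : ℕ) : Type := Metric.ball (0 : E m) 1

/-- The centre of the disc. -/
def Disc.center (m : ℕ) : Disc m := ⟨0, Metric.mem_ball_self one_pos⟩

/-- The disjoint union of `k` copies of the open unit disc `Dᵐ`. -/
abbrev Discs (k m : ℕ) : Type := Σ _ : Fin k, Disc m

variable {k m n r : ℕ}

/-- The restriction of `f` to the `i`-th disc, extended by zero to the whole of `ℝᵐ`. It is only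
ever differentiated at points of the open disc, where the extension plays no role. -/
def component (f : Discs k m → E n) (i : Fin k) (x : E m) : E n :=
  open Classical in if h : x ∈ Metric.ball (0 : E m) 1 then f ⟨i, ⟨x, h⟩⟩ else 0

/-- The set `C^∞(∐ₖ Dᵐ, ℝⁿ)` of smooth maps. -/
@[ext]
structure SmoothMap (k m n : ℕ) where
  /-- The underlying function. -/
  toFun : Discs k m → E n
  smooth' : ∀ i : Fin k, ContDiffOn ℝ ∞ (component toFun i) (Metric.ball (0 : E m) 1)

namespace SmoothMap

instance : CoeFun (SmoothMap k m n) fun _ => Discs k m → E n := ⟨toFun⟩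

/-- The `j`-th total derivative of a smooth map on the `i`-th disc, as a continuous function. -/
def derivOn (f : SmoothMap k m n) (i : Fin k) (j : ℕ) :
    C(Disc m, ContinuousMultilinearMap ℝ (fun _ : Fin j => E m) (E n)) where
  toFun x := iteratedFDeriv ℝ j (component f i) x
  continuous_toFun := by
    have h := ((f.smooth' i).continuousOn_iteratedFDerivWithin (m := j)
      (by exact_mod_cast le_top) Metric.isOpen_ball.uniqueDiffOn)
    exact continuousOn_iff_continuous_domRestrict.1
      (h.congr fun x hx => (iteratedFDerivWithin_of_isOpen j Metric.isOpen_ball hx).symm)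

/-- The compact-open `C^∞` topology (weak Whitney topology): the coarsest topology for which every
total derivative, on every disc, depends continuously on the map in the compact-open topology, that
is, in the topology of uniform convergence on compact subsets. -/
instance : TopologicalSpace (SmoothMap k m n) :=
  TopologicalSpace.induced (fun f (i : Fin k) (j : ℕ) => f.derivOn i j) inferInstance

/-- A smooth map is an immersion if its differential is injective at every point. -/
def IsImmersion (f : SmoothMap k m n) : Prop :=
  ∀ (i : Fin k) (x : Disc m), Function.Injective (fderiv ℝ (component f i) (x : E m))

/-- An `r`-immersion is an immersion such that the preimage of each point consists of fewer than
`r` points. -/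
def IsRImmersion (r : ℕ) (f : SmoothMap k m n) : Prop :=
  f.IsImmersion ∧ ∀ y : E n, ((f : Discs k m → E n) ⁻¹' {y}).encard < r

/-- Evaluation at a point is continuous. -/
theorem continuous_eval (p : Discs k m) : Continuous fun f : SmoothMap k m n => f p := by
  obtain ⟨i, x⟩ := p
  have h0 : Continuous fun (f : SmoothMap k m n) (i : Fin k) (j : ℕ) => f.derivOn i j :=
    continuous_induced_dom
  have h1 : Continuous fun f : SmoothMap k m n => f.derivOn i 0 :=
    continuous_pi_iff.1 (continuous_pi_iff.1 h0 i) 0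
  have h2 : Continuous fun f : SmoothMap k m n => f.derivOn i 0 x (0 : Fin 0 → E m) :=
    (continuous_eval_const (0 : Fin 0 → E m)).comp ((continuous_eval_const x).comp h1)
  refine h2.congr fun f => ?_
  change iteratedFDeriv ℝ 0 (component f i) (x : E m) 0 = f ⟨i, x⟩
  rw [iteratedFDeriv_zero_apply]
  simp only [component, dif_pos x.2]

end SmoothMap

/-- The space `Imm(∐ₖ Dᵐ, ℝⁿ)` of immersions, with the subspace topology. -/
abbrev Imm (k m n : ℕ) : Type := {f : SmoothMap k m n // f.IsImmersion}

/-- The space `rImm(∐ₖ Dᵐ, ℝⁿ)` of `r`-immersions, with the subspace topology. -/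
abbrev RImm (r k m n : ℕ) : Type := {f : SmoothMap k m n // f.IsRImmersion r}

/-- The `r`-configuration space `rConf(k, ℝⁿ)`: `k`-tuples of points of `ℝⁿ` no `r` of which
coincide, as a subspace of `(ℝⁿ)ᵏ`. -/
abbrev RConf (r k n : ℕ) : Type :=
  {x : Fin k → E n // ¬ ∃ i : Fin r → Fin k, StrictMono i ∧ ∀ a b, x (i a) = x (i b)}

/-- The inclusion `rImm(∐ₖ Dᵐ, ℝⁿ) → Imm(∐ₖ Dᵐ, ℝⁿ)`. -/
def rImmToImm (r k m n : ℕ) : C(RImm r k m n, Imm k m n) where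
  toFun f := ⟨f.1, f.2.1⟩
  continuous_toFun := continuous_subtype_val.subtype_mk _

/-- The values at the disc centres of an `r`-immersion form an `r`-configuration. -/
theorem evalCenters_mem (f : RImm r k m n) :
    ¬ ∃ i : Fin r → Fin k, StrictMono i ∧
      ∀ a b, f.1 ⟨i a, Disc.center m⟩ = f.1 ⟨i b, Disc.center m⟩ := by
  rintro ⟨i, hi, h⟩
  rcases Nat.eq_zero_or_pos r with rfl | hr
  · simpa using f.2.2 0
  · let a₀ : Fin r := ⟨0, hr⟩
    have hlt := f.2.2 (f.1 ⟨i a₀, Disc.center m⟩)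
    let g : Fin r → Discs k m := fun a => ⟨i a, Disc.center m⟩
    have hg : Function.Injective g := fun a b hab => hi.injective (congrArg Sigma.fst hab)
    have hsub : Set.range g ⊆ (f.1 : Discs k m → E n) ⁻¹' {f.1 ⟨i a₀, Disc.center m⟩} := by
      rintro _ ⟨a, rfl⟩
      exact h a a₀
    have hle := Set.encard_le_encard hsub
    rw [← Set.image_univ, hg.encard_image, Set.encard_univ, ENat.card_eq_coe_fintype_card,
      Fintype.card_fin] at hle
    exact absurd hlt (not_lt.2 hle)

/-- Evaluation at the disc centres, `rImm(∐ₖ Dᵐ, ℝⁿ) → rConf(k, ℝⁿ)`. -/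
def evalCenters (r k m n : ℕ) : C(RImm r k m n, RConf r k n) where
  toFun f := ⟨fun i => f.1 ⟨i, Disc.center m⟩, evalCenters_mem f⟩
  continuous_toFun := Continuous.subtype_mk
    (continuous_pi fun _ => (SmoothMap.continuous_eval _).comp continuous_subtype_val) _

end RImmersion

end

/-! On a small enough disc an immersion is close to its affine approximation at the centre. Up to
homotopy an immersion of the discs is therefore given by its centre values and by injective linear
maps `E m → E n`, one per disc; an `r`-immersion is given by the same data with the centre values in
`RConf`. The frames cancel in the homotopy fibre over `b`, and only the configuration remains.

The proof replaces this comparison of fibrations by one explicit homotopy. `contractMap` first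
shrinks the discs to a radius `nearRadius` and then interpolates linearly to the differential. The
radius depends continuously on the immersion `g` and on a configuration `x`. It is so small that the
interpolation runs through immersions (`isImmersion_contractMap`), and that with centre values `x`
it runs through `r`-immersions whether or not `g` is one (`isRImmersion_contractMap_of_ge`). The
shrinking stage preserves `r`-immersions because it is precomposition with an injection.

For a point `(f, γ)` of the fibre with centre values `x`, `contractFamily` is a square of
immersions. Its edge `s = 0` is `γ`, and its edge `t = 1` is constantly `b`. Its edge `t = 0`
contracts `f` to its differentials and then carries these along `γ` to those of `b`, always with
centre values `x`. Its edge `s = 1` depends only on `x` and `b`, and so defines a section of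
`fiberEval`. The square is a homotopy from the identity to section after evaluation which preserves
centre values. `isWeakHomotopyEquiv_of_vertical_homotopy` concludes; as the homotopy moves base
points, their tracks are absorbed in a collar of the cube. -/

noncomputable section

namespace RImmersion

/-! ### Maps with a section and a vertical contraction are weak homotopy equivalences -/

section Cube

variable {d : ℕ}

/-- The distance of a point of the cube to the centre, normalised to be `1` on the boundary. -/
def cubeRadius (y : I^ (Fin d)) : ℝ := 2 * ‖fun i => (y i : ℝ) - 1 / 2‖

/-- The cube is blown up radially, so that for `s = 1` everything outside the concentric cube
of half the size is mapped to the boundary. -/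
def cubeExpand (s : ℝ) (y : I^ (Fin d)) : I^ (Fin d) := fun i =>
  Set.projIcc 0 1 zero_le_one (1 / 2 + ((y i : ℝ) - 1 / 2) / max (1 - s / 2) (cubeRadius y))

/-- The collar coordinate of a point of the cube: `0` on the boundary and `1` on the concentric
cube of half the size. -/
def cubeCollar (y : I^ (Fin d)) : I := Set.projIcc 0 1 zero_le_one (2 - 2 * cubeRadius y)

theorem continuous_cubeRadius : Continuous (cubeRadius (d := d)) := by
  unfold cubeRadius
  fun_prop

theorem continuous_cubeCollar : Continuous (cubeCollar (d := d)) :=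
  continuous_projIcc.comp (continuous_const.sub (continuous_const.mul continuous_cubeRadius))

theorem continuous_cubeExpand :
    Continuous fun q : I × (I^ (Fin d)) => cubeExpand (q.1 : ℝ) q.2 := by
  refine continuous_pi fun i => continuous_projIcc.comp ?_
  refine continuous_const.add (Continuous.div (by fun_prop) ?_ ?_)
  · exact Continuous.max (by fun_prop) (continuous_cubeRadius.comp continuous_snd)
  · intro q
    exact ((by linarith [q.1.2.2] : (0 : ℝ) < 1 - (q.1 : ℝ) / 2).trans_le (le_max_left _ _)).ne'

theorem continuous_cubeExpand_one : Continuous (cubeExpand (d := d) 1) := by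
  exact (continuous_cubeExpand (d := d)).comp (Continuous.prodMk_right (1 : I))

theorem abs_sub_half_le (y : I^ (Fin d)) (i : Fin d) : |(y i : ℝ) - 1 / 2| ≤ 1 / 2 := by
  rw [abs_le]; constructor <;> linarith [(y i).2.1, (y i).2.2]

theorem cubeRadius_le_one (y : I^ (Fin d)) : cubeRadius y ≤ 1 := by
  have : ‖fun i => (y i : ℝ) - 1 / 2‖ ≤ 1 / 2 :=
    (pi_norm_le_iff_of_nonneg (by norm_num)).2 fun i => abs_sub_half_le y i
  unfold cubeRadius
  linarith

theorem cubeRadius_of_mem_boundary {y : I^ (Fin d)} (hy : y ∈ Cube.boundary (Fin d)) :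
    cubeRadius y = 1 := by
  refine le_antisymm (cubeRadius_le_one y) ?_
  obtain ⟨i, hi⟩ := hy
  have h1 : |(y i : ℝ) - 1 / 2| ≤ ‖fun i => (y i : ℝ) - 1 / 2‖ :=
    norm_le_pi_norm (fun i => (y i : ℝ) - 1 / 2) i
  have h2 : |(y i : ℝ) - 1 / 2| = 1 / 2 := by
    rcases hi with hi | hi <;> rw [hi] <;> norm_num [abs_of_nonneg, abs_of_neg]
  unfold cubeRadius
  linarith

theorem cubeExpand_eq_self {s : ℝ} {y : I^ (Fin d)} (h : max (1 - s / 2) (cubeRadius y) = 1) :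
    cubeExpand s y = y := by
  funext i
  have : (1 : ℝ) / 2 + ((y i : ℝ) - 1 / 2) / 1 = y i := by ring
  simp only [cubeExpand, h, this, Set.projIcc_val]

theorem cubeExpand_zero (y : I^ (Fin d)) : cubeExpand 0 y = y :=
  cubeExpand_eq_self (by simpa using cubeRadius_le_one y)

theorem cubeExpand_of_mem_boundary {s : ℝ} (hs : 0 ≤ s) {y : I^ (Fin d)}
    (hy : y ∈ Cube.boundary (Fin d)) : cubeExpand s y = y :=
  cubeExpand_eq_self (by rw [cubeRadius_of_mem_boundary hy, max_eq_right]; linarith)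

theorem cubeExpand_one_mem_boundary {y : I^ (Fin d)} (hy : 1 / 2 ≤ cubeRadius y) :
    cubeExpand 1 y ∈ Cube.boundary (Fin d) := by
  -- A coordinate attaining the sup norm; it exists because the radius is positive, which excludes
  -- `d = 0`.
  obtain ⟨i, hi⟩ : ∃ i, cubeRadius y / 2 ≤ |(y i : ℝ) - 1 / 2| := by
    by_contra! h
    have := (pi_norm_lt_iff (x := fun i => (y i : ℝ) - 1 / 2)
      (by linarith : 0 < cubeRadius y / 2)).2 h
    unfold cubeRadius at this
    linarith
  have hm : max (1 - (1 : ℝ) / 2) (cubeRadius y) = cubeRadius y :=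
    max_eq_right (by linarith)
  have h0 : 0 < cubeRadius y := by linarith
  refine ⟨i, ?_⟩
  simp only [cubeExpand, hm]
  rcases le_abs.1 hi with h | h
  · refine Or.inr (Set.projIcc_of_right_le _ ?_)
    have : 1 / 2 ≤ ((y i : ℝ) - 1 / 2) / cubeRadius y := by rw [le_div_iff₀ h0]; linarith
    linarith
  · refine Or.inl (Set.projIcc_of_le_left _ ?_)
    have : ((y i : ℝ) - 1 / 2) / cubeRadius y ≤ -(1 / 2) := by rw [div_le_iff₀ h0]; linarith
    linarith

theorem cubeCollar_of_mem_boundary {y : I^ (Fin d)} (hy : y ∈ Cube.boundary (Fin d)) :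
    cubeCollar y = 0 :=
  Set.projIcc_of_le_left _ (by rw [cubeRadius_of_mem_boundary hy]; norm_num)

theorem cubeCollar_of_le {y : I^ (Fin d)} (hy : cubeRadius y ≤ 1 / 2) : cubeCollar y = 1 :=
  Set.projIcc_of_right_le _ (by linarith)

variable {X Y : Type*} [TopologicalSpace X] [TopologicalSpace Y]

/-- The map on the cube given by a homotopy on a collar and by the end of the homotopy inside. -/
def collarMap (F : C(I × (I^ (Fin d)), X)) : C(I^ (Fin d), X) where
  toFun y := F (cubeCollar y, cubeExpand 1 y)
  continuous_toFun :=
    F.continuous.comp (continuous_cubeCollar.prodMk continuous_cubeExpand_one)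

/-- Run `F` up to time `t` times the collar coordinate while the cube expands. The collar coordinate
vanishes on the boundary, so the boundary stays fixed even if `F` moves it. -/
theorem homotopicRel_collarMap (F : C(I × (I^ (Fin d)), X)) (f : C(I^ (Fin d), X))
    (hf : ∀ y, F (0, y) = f y) : f.HomotopicRel (collarMap F) (Cube.boundary (Fin d)) := by
  refine ⟨⟨⟨⟨fun q => F (q.1 * cubeCollar q.2, cubeExpand (q.1 : ℝ) q.2), ?_⟩, ?_, ?_⟩, ?_⟩⟩
  · exact F.continuous.comp ((continuous_fst.mul (continuous_cubeCollar.comp continuous_snd)).prodMk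
      continuous_cubeExpand)
  · intro y
    simp [cubeExpand_zero, hf]
  · intro y
    simp [collarMap]
  · intro t y hy
    simp [cubeCollar_of_mem_boundary hy, cubeExpand_of_mem_boundary t.2.1 hy, hf]

/-- Gluing a map on the cube, constant on the boundary, and a path on a collar of the boundary. -/
theorem continuous_collar_glue {T : Type*} [TopologicalSpace T] {G : T × (I^ (Fin d)) → X}
    (hG : Continuous G) {w : I → X} (hw : Continuous w)
    (h : ∀ t, ∀ y ∈ Cube.boundary (Fin d), G (t, y) = w 1) :
    Continuous fun q : T × (I^ (Fin d)) =>
      if cubeRadius q.2 ≤ 1 / 2 then G (q.1, cubeExpand 1 q.2) else w (cubeCollar q.2) := by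
  refine Continuous.if_le ?_ ?_ (continuous_cubeRadius.comp continuous_snd) continuous_const ?_
  · exact hG.comp (continuous_fst.prodMk (continuous_cubeExpand_one.comp continuous_snd))
  · exact hw.comp (continuous_cubeCollar.comp continuous_snd)
  · intro q hq
    rw [h _ _ (cubeExpand_one_mem_boundary hq.ge), cubeCollar_of_le hq.le]

/-- A map with a section `e` such that `e ∘ p` is vertically homotopic to the identity is a weak
homotopy equivalence. -/
theorem isWeakHomotopyEquiv_of_vertical_homotopy (p : C(X, Y)) (e : C(Y, X)) (h : C(X × I, X))
    (he : ∀ y, p (e y) = y) (h0 : ∀ x, h (x, 0) = x) (h1 : ∀ x, h (x, 1) = e (p x))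
    (hp : ∀ x t, p (h (x, t)) = p x) : IsWeakHomotopyEquiv p := by
  refine ⟨⟨?_, ?_⟩, fun d _ x => ⟨?_, ?_⟩⟩
  · rintro ⟨x⟩ ⟨y⟩ hxy
    have hj : Joined (p x) (p y) := Quotient.exact hxy
    have key : ∀ x, Joined x (e (p x)) := fun x =>
      ⟨⟨⟨fun t => h (x, t), by fun_prop⟩, h0 x, h1 x⟩⟩
    exact Quotient.sound (((key x).trans (hj.map e.continuous)).trans (key y).symm)
  · rintro ⟨y⟩
    exact ⟨Quotient.mk _ (e y), congrArg (Quotient.mk _) (he y)⟩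
  · rintro ⟨α⟩ ⟨β⟩ hαβ
    obtain ⟨H⟩ : (genLoopMap (Fin d) p x α).1.HomotopicRel (genLoopMap (Fin d) p x β).1
      (Cube.boundary (Fin d)) := Quotient.exact hαβ
    have hH0 : ∀ y, H (0, y) = p (α y) := fun y => H.apply_zero y
    have hH1 : ∀ y, H (1, y) = p (β y) := fun y => H.apply_one y
    let Fα : C(I × (I^ (Fin d)), X) := ⟨fun q => h (α q.2, q.1),
      h.continuous.comp ((α.1.continuous.comp continuous_snd).prodMk continuous_fst)⟩
    let Fβ : C(I × (I^ (Fin d)), X) := ⟨fun q => h (β q.2, q.1),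
      h.continuous.comp ((β.1.continuous.comp continuous_snd).prodMk continuous_fst)⟩
    have hα := homotopicRel_collarMap Fα α.1 fun y => h0 _
    have hβ := homotopicRel_collarMap Fβ β.1 fun y => h0 _
    -- The collar form of a loop is `e ∘ p ∘ γ` on the inner cube and, on the collar, the track of
    -- the base point under `h`, which does not depend on `γ`.
    have hcol : ∀ (γ : GenLoop (Fin d) X x) (y : I^ (Fin d)),
        (if cubeRadius y ≤ 1 / 2 then e (p (γ (cubeExpand 1 y))) else h (x, cubeCollar y)) =
          h (γ (cubeExpand 1 y), cubeCollar y) := by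
      intro γ y
      split_ifs with hy
      · rw [cubeCollar_of_le hy, h1]
      · rw [GenLoop.boundary γ _ (cubeExpand_one_mem_boundary (not_le.1 hy).le)]
    -- The homotopy `e ∘ H` fills the inner cube; the collar is kept constant.
    have hmid : (collarMap Fα).HomotopicRel (collarMap Fβ) (Cube.boundary (Fin d)) := by
      refine ⟨⟨⟨⟨_, continuous_collar_glue (G := fun q : I × (I^ (Fin d)) => e (H q))
        (by fun_prop) (w := fun t => h (x, t)) (by fun_prop) ?_⟩, ?_, ?_⟩, ?_⟩⟩
      · intro t y hy
        rw [H.eq_fst t hy, h1]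
        exact congrArg (fun z => e (p z)) (α.2 y hy)
      · intro y
        simp only [hH0]
        exact hcol α y
      · intro y
        simp only [hH1]
        exact hcol β y
      · intro t y hy
        have hr := cubeRadius_of_mem_boundary hy
        have hn : ¬ cubeRadius y ≤ 1 / 2 := by rw [hr]; norm_num
        exact (if_neg hn).trans ((if_neg hn).symm.trans (hcol α y))
    exact Quotient.sound ((hα.trans hmid).trans hβ.symm)
  · rintro ⟨β⟩
    -- `e ∘ β` is based at `e (p x)`; the track of `x` on the collar moves the base point to `x`.
    -- Since `p` is constant along this track, `p ∘ a` is just `β` expanded.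
    let a : C(I^ (Fin d), X) := ⟨fun y => if cubeRadius y ≤ 1 / 2 then e (β (cubeExpand 1 y))
        else h (x, cubeCollar y), by
      have := continuous_collar_glue (T := Unit) (G := fun q : Unit × (I^ (Fin d)) => e (β q.2))
        (e.continuous.comp (β.1.continuous.comp continuous_snd)) (w := fun t => h (x, t))
        (by fun_prop) (fun t y hy => by rw [h1]; exact congrArg e (β.2 y hy))
      exact this.comp (Continuous.prodMk_right ())⟩
    have ha : ∀ y ∈ Cube.boundary (Fin d), a y = x := by
      intro y hy
      change (if cubeRadius y ≤ 1 / 2 then _ else h (x, cubeCollar y)) = _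
      rw [if_neg (by rw [cubeRadius_of_mem_boundary hy]; norm_num), cubeCollar_of_mem_boundary hy,
        h0]
    refine ⟨Quotient.mk _ ⟨a, ha⟩, Quotient.sound ?_⟩
    let F : C(I × (I^ (Fin d)), Y) := ⟨fun q => β q.2, β.1.continuous.comp continuous_snd⟩
    have hF := homotopicRel_collarMap F β.1 fun y => rfl
    have hpa : (genLoopMap (Fin d) p x ⟨a, ha⟩).1 = collarMap F := by
      ext y
      change p (if cubeRadius y ≤ 1 / 2 then _ else h (x, cubeCollar y)) = β (cubeExpand 1 y)
      split_ifs with hy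
      · exact he _
      · rw [hp]
        exact (β.2 _ (cubeExpand_one_mem_boundary (not_le.1 hy).le)).symm
    change (genLoopMap (Fin d) p x ⟨a, ha⟩).1.HomotopicRel β.1 _
    rw [hpa]
    exact hF.symm

end Cube

/-! ### Rescaled and perturbed smooth maps -/

section Deform

variable {k m n r : ℕ}

theorem component_apply (f : Discs k m → E n) (i : Fin k) (x : Disc m) :
    component f i x = f ⟨i, x⟩ := dif_pos x.2

theorem smul_mem_ball (l : I) {x : E m} (hx : x ∈ Metric.ball (0 : E m) 1) :
    (l : ℝ) • x ∈ Metric.ball (0 : E m) 1 := by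
  rw [mem_ball_zero_iff] at hx ⊢
  rw [norm_smul, Real.norm_of_nonneg l.2.1]
  exact (mul_le_of_le_one_left (norm_nonneg x) l.2.2).trans_lt hx

namespace SmoothMap

theorem contDiffAt_component (f : SmoothMap k m n) (i : Fin k) {x : E m}
    (hx : x ∈ Metric.ball (0 : E m) 1) : ContDiffAt ℝ ∞ (component f i) x :=
  (f.smooth' i).contDiffAt (Metric.isOpen_ball.mem_nhds hx)

theorem differentiableAt_component (f : SmoothMap k m n) (i : Fin k) {x : E m}
    (hx : x ∈ Metric.ball (0 : E m) 1) : DifferentiableAt ℝ (component f i) x :=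
  (f.contDiffAt_component i hx).differentiableAt (by simp)

theorem contDiffAt_component_smul (f : SmoothMap k m n) (i : Fin k) (l : I) {x : E m}
    (hx : x ∈ Metric.ball (0 : E m) 1) :
    ContDiffAt ℝ ∞ (fun y => component f i ((l : ℝ) • y)) x :=
  (f.contDiffAt_component i (smul_mem_ball l hx)).comp x (contDiffAt_id.const_smul _)

theorem continuous_derivOn (i : Fin k) (j : ℕ) :
    Continuous fun f : SmoothMap k m n => f.derivOn i j :=
  continuous_pi_iff.1 (continuous_pi_iff.1
    (continuous_induced_dom : Continuous fun (f : SmoothMap k m n) i j => f.derivOn i j) i) j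

theorem continuous_iteratedFDeriv (i : Fin k) (j : ℕ) :
    Continuous fun q : SmoothMap k m n × Disc m => iteratedFDeriv ℝ j (component q.1 i) q.2 := by
  have : LocallyCompactSpace (Disc m) := Metric.isOpen_ball.locallyCompactSpace
  exact ((continuous_derivOn i j).comp continuous_fst).eval continuous_snd

theorem continuous_of_iteratedFDeriv {T : Type*} [TopologicalSpace T] {F : T → SmoothMap k m n}
    (h : ∀ i j, Continuous fun q : T × Disc m => iteratedFDeriv ℝ j (component (F q.1) i) q.2) :
    Continuous F :=
  continuous_induced_rng.2 <| continuous_pi fun i => continuous_pi fun j =>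
    ContinuousMap.continuous_of_continuous_uncurry _ (h i j)

theorem continuous_fderiv (i : Fin k) :
    Continuous fun q : SmoothMap k m n × Disc m => fderiv ℝ (component q.1 i) q.2 := by
  have h := (continuousMultilinearCurryFin1 ℝ (E m) (E n)).continuous.comp
    (continuous_iteratedFDeriv (k := k) (m := m) (n := n) i 1)
  refine h.congr fun q => ?_
  ext v
  simp [iteratedFDeriv_one_apply]

/-- The smooth map `x ↦ vᵢ + αᵢ g(lᵢ x) + Lᵢ x` on the `i`-th disc. -/
def deform (v : Fin k → E n) (α : Fin k → ℝ) (l : Fin k → I) (L : Fin k → E m →L[ℝ] E n)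
    (g : SmoothMap k m n) : SmoothMap k m n where
  toFun q := v q.1 + α q.1 • component g q.1 ((l q.1 : ℝ) • (q.2 : E m)) + L q.1 q.2
  smooth' i := by
    have h : ContDiffOn ℝ ∞ (fun x => v i + α i • component g i ((l i : ℝ) • x) + L i x)
        (Metric.ball (0 : E m) 1) := fun x hx =>
      ((contDiffAt_const.add ((g.contDiffAt_component_smul i (l i) hx).const_smul (α i))).add
        (L i).contDiff.contDiffAt).contDiffWithinAt
    exact h.congr fun x hx => dif_pos hx

variable {v : Fin k → E n} {α : Fin k → ℝ} {l : Fin k → I} {L : Fin k → E m →L[ℝ] E n}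
  {g : SmoothMap k m n} {i : Fin k} {x : E m}

theorem component_deform (hx : x ∈ Metric.ball (0 : E m) 1) :
    component (deform v α l L g) i x = v i + α i • component g i ((l i : ℝ) • x) + L i x :=
  dif_pos hx

theorem component_deform_eventuallyEq (hx : x ∈ Metric.ball (0 : E m) 1) :
    component (deform v α l L g) i =ᶠ[𝓝 x]
      (fun _ => v i) + α i • (fun y => component g i ((l i : ℝ) • y)) + ⇑(L i) :=
  Filter.eventuallyEq_of_mem (Metric.isOpen_ball.mem_nhds hx) fun _ hy => component_deform hy

theorem fderiv_deform (hx : x ∈ Metric.ball (0 : E m) 1) :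
    fderiv ℝ (component (deform v α l L g) i) x =
      (α i * l i) • fderiv ℝ (component g i) ((l i : ℝ) • x) + L i := by
  rw [(component_deform_eventuallyEq hx).fderiv_eq]
  have h1 : HasFDerivAt (fun y : E m => component g i ((l i : ℝ) • y))
      ((fderiv ℝ (component g i) ((l i : ℝ) • x)).comp ((l i : ℝ) • ContinuousLinearMap.id ℝ (E m)))
      x :=
    (g.differentiableAt_component i (smul_mem_ball (l i) hx)).hasFDerivAt.comp x
      ((hasFDerivAt_id x).const_smul (l i : ℝ))
  refine ((((hasFDerivAt_const (v i) x).add (h1.const_smul (α i))).add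
    (L i).hasFDerivAt)).fderiv.trans ?_
  ext w
  simp [mul_smul]

theorem iteratedFDeriv_component_smul (g : SmoothMap k m n) (i : Fin k) (l : I) (j : ℕ)
    (hx : x ∈ Metric.ball (0 : E m) 1) :
    iteratedFDeriv ℝ j (fun y => component g i ((l : ℝ) • y)) x =
      (l : ℝ) ^ j • iteratedFDeriv ℝ j (component g i) ((l : ℝ) • x) := by
  let A : E m →L[ℝ] E m := (l : ℝ) • ContinuousLinearMap.id ℝ (E m)
  -- The factor `l` may be zero, so `A` need not be invertible; the chain rule is applied on the
  -- open preimage of the ball.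
  have ho : IsOpen (A ⁻¹' Metric.ball (0 : E m) 1) := Metric.isOpen_ball.preimage A.continuous
  have hA : A x ∈ Metric.ball (0 : E m) 1 := smul_mem_ball l hx
  have h := A.iteratedFDerivWithin_comp_right (g.smooth' i) Metric.isOpen_ball.uniqueDiffOn
    ho.uniqueDiffOn hA (i := j) (by exact_mod_cast le_top)
  rw [iteratedFDerivWithin_of_isOpen j ho hA,
    iteratedFDerivWithin_of_isOpen j Metric.isOpen_ball hA] at h
  refine h.trans ?_
  ext1 w
  change iteratedFDeriv ℝ j (component g i) (A x) (fun a => (l : ℝ) • w a) = _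
  rw [ContinuousMultilinearMap.map_smul_univ]
  simp [A]

theorem iteratedFDeriv_deform (j : ℕ) (hx : x ∈ Metric.ball (0 : E m) 1) :
    iteratedFDeriv ℝ j (component (deform v α l L g) i) x =
      iteratedFDeriv ℝ j (fun _ => v i) x +
        α i • (l i : ℝ) ^ j • iteratedFDeriv ℝ j (component g i) ((l i : ℝ) • x) +
        iteratedFDeriv ℝ j (L i) x := by
  have hj : (j : WithTop ℕ∞) ≤ ∞ := by exact_mod_cast le_top
  have h1 : ContDiffAt ℝ j (fun _ : E m => v i) x := contDiffAt_const
  have h2 : ContDiffAt ℝ j (fun y => component g i ((l i : ℝ) • y)) x :=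
    (g.contDiffAt_component_smul i (l i) hx).of_le hj
  have h2' : ContDiffAt ℝ j (α i • fun y => component g i ((l i : ℝ) • y)) x := h2.const_smul (α i)
  have h12 : ContDiffAt ℝ j ((fun _ => v i) + α i • fun y => component g i ((l i : ℝ) • y)) x :=
    h1.add h2'
  have h3 : ContDiffAt ℝ j (L i) x := (L i).contDiff.contDiffAt
  rw [((component_deform_eventuallyEq hx).iteratedFDeriv ℝ j).eq_of_nhds,
    iteratedFDeriv_add_apply h12 h3, iteratedFDeriv_add_apply h1 h2',
    iteratedFDeriv_const_smul_apply h2,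
    iteratedFDeriv_component_smul g i (l i) j hx]

end SmoothMap

theorem continuous_iteratedFDeriv_const (j : ℕ) :
    Continuous fun q : E n × E m => iteratedFDeriv ℝ j (fun _ : E m => q.1) q.2 := by
  cases j with
  | zero =>
    simp only [iteratedFDeriv_zero_eq_comp]
    exact (LinearIsometryEquiv.continuous _).comp continuous_fst
  | succ j => simp only [iteratedFDeriv_succ_const]; exact continuous_const

theorem continuous_iteratedFDeriv_clm (j : ℕ) :
    Continuous fun q : (E m →L[ℝ] E n) × E m => iteratedFDeriv ℝ j q.1 q.2 := by
  cases j with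
  | zero =>
    simp only [iteratedFDeriv_zero_eq_comp]
    exact (LinearIsometryEquiv.continuous _).comp (continuous_fst.clm_apply continuous_snd)
  | succ j =>
    simp only [iteratedFDeriv_succ_eq_comp_right, ContinuousLinearMap.fderiv]
    refine (LinearIsometryEquiv.continuous _).comp ?_
    cases j with
    | zero =>
      simp only [iteratedFDeriv_zero_eq_comp]
      exact (LinearIsometryEquiv.continuous _).comp continuous_fst
    | succ j => simp only [iteratedFDeriv_succ_const]; exact continuous_const

theorem SmoothMap.continuous_deform {T : Type*} [TopologicalSpace T] {v : T → Fin k → E n}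
    {α : T → Fin k → ℝ} {l : T → Fin k → I} {L : T → Fin k → E m →L[ℝ] E n}
    {g : T → SmoothMap k m n} (hv : Continuous v) (hα : Continuous α) (hl : Continuous l)
    (hL : Continuous L) (hg : Continuous g) :
    Continuous fun t => deform (v t) (α t) (l t) (L t) (g t) := by
  refine continuous_of_iteratedFDeriv fun i j => ?_
  simp only [fun q : T × Disc m => iteratedFDeriv_deform (v := v q.1) (α := α q.1) (l := l q.1)
    (L := L q.1) (g := g q.1) (i := i) j q.2.2]
  have hv' := (continuous_apply i).comp hv
  have hα' := (continuous_apply i).comp hα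
  have hl' := (continuous_apply i).comp hl
  have hL' := (continuous_apply i).comp hL
  have hlr : Continuous fun q : T × Disc m => ((l q.1 i : I) : ℝ) :=
    continuous_subtype_val.comp (hl'.comp continuous_fst)
  have hx : Continuous fun q : T × Disc m => (q.2 : E m) :=
    continuous_subtype_val.comp continuous_snd
  refine ((continuous_iteratedFDeriv_const j).comp ((hv'.comp continuous_fst).prodMk hx)).add
    ((hα'.comp continuous_fst).smul ((hlr.pow j).smul ?_)) |>.add
    ((continuous_iteratedFDeriv_clm j).comp ((hL'.comp continuous_fst).prodMk hx))
  exact (continuous_iteratedFDeriv i j).comp ((hg.comp continuous_fst).prodMk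
    (Continuous.subtype_mk (hlr.smul hx) fun q => smul_mem_ball (l q.1 i) q.2.2))

end Deform

/-! ### Contraction of immersions to their differentials at the centres -/

section Contract

variable {k m n r : ℕ}

/-- The admissible constants form an interval, and one of them works near each `A`, so local
constants can be glued by a partition of unity. -/
theorem exists_injectivity_modulus (m n : ℕ) :
    ∃ c : C({A : E m →L[ℝ] E n // Function.Injective A}, ℝ),
      ∀ A, c A ∈ {c : ℝ | 0 < c ∧ ∀ v, c * ‖v‖ ≤ ‖A.1 v‖} := by
  refine exists_continuous_forall_mem_convex_of_local_const (fun A => ?_) fun A => ?_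
  · refine Set.OrdConnected.convex ⟨fun a ha b hb c hc => ⟨ha.1.trans_le hc.1, fun v => ?_⟩⟩
    exact (mul_le_mul_of_nonneg_right hc.2 (norm_nonneg v)).trans (hb.2 v)
  · obtain ⟨K, hK, hA⟩ := LinearMap.exists_antilipschitzWith A.1.toLinearMap
      (LinearMap.ker_eq_bot.2 A.2)
    have hK' : (0 : ℝ) < K := hK
    have hc : 0 < (K : ℝ)⁻¹ / 2 := by positivity
    -- Half of the lower bound `K⁻¹` for `A` absorbs a perturbation of norm at most the other half.
    refine ⟨(K : ℝ)⁻¹ / 2, ?_⟩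
    filter_upwards [Metric.ball_mem_nhds A hc] with B hB
    refine ⟨hc, fun v => ?_⟩
    have h1 : ‖v‖ ≤ K * ‖A.1 v‖ := by
      simpa using hA.le_mul_dist v 0
    have h2 : (K : ℝ)⁻¹ * ‖v‖ ≤ ‖A.1 v‖ := by
      rw [inv_mul_le_iff₀ hK']; exact h1
    have h3 : ‖(A.1 - B.1) v‖ ≤ (K : ℝ)⁻¹ / 2 * ‖v‖ := by
      refine ((A.1 - B.1).le_opNorm v).trans (mul_le_mul_of_nonneg_right ?_ (norm_nonneg v))
      rw [← dist_eq_norm, dist_comm]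
      exact (Metric.mem_ball.1 hB).le
    have h4 : ‖A.1 v‖ ≤ ‖(A.1 - B.1) v‖ + ‖B.1 v‖ := by
      simpa using norm_add_le ((A.1 - B.1) v) (B.1 v)
    linarith

/-- A continuous positive lower bound for an injective linear map on the unit sphere. -/
def injectivityModulus (m n : ℕ) : C({A : E m →L[ℝ] E n // Function.Injective A}, ℝ) :=
  (exists_injectivity_modulus m n).choose

theorem injectivityModulus_pos (A : {A : E m →L[ℝ] E n // Function.Injective A}) :
    0 < injectivityModulus m n A := ((exists_injectivity_modulus m n).choose_spec A).1

theorem injectivityModulus_mul_norm_le (A : {A : E m →L[ℝ] E n // Function.Injective A}) (v : E m) :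
    injectivityModulus m n A * ‖v‖ ≤ ‖A.1 v‖ :=
  ((exists_injectivity_modulus m n).choose_spec A).2 v

/-! ### Separation of `r`-configurations -/

theorem encard_lt_of_eq (x : RConf r k n) {s : Set (Fin k)}
    (hs : ∀ i ∈ s, ∀ j ∈ s, x.1 i = x.1 j) : s.encard < r := by
  classical
  by_contra! h
  have hcard : r ≤ s.toFinset.card := by
    rw [Set.encard_eq_coe_toFinset_card] at h
    exact_mod_cast h
  obtain ⟨t, ht, htr⟩ := Finset.exists_subset_card_eq hcard
  refine x.2 ⟨t.orderEmbOfFin htr, (t.orderEmbOfFin htr).strictMono, fun a b => hs _ ?_ _ ?_⟩ <;>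
    exact Set.mem_toFinset.1 (ht (t.orderEmbOfFin_mem htr _))

/-- The least distance between distinct points is not continuous where points merge, hence again a
partition of unity over local constants. -/
theorem exists_separation (r k n : ℕ) :
    ∃ e : C(RConf r k n, ℝ),
      ∀ x, e x ∈ {e : ℝ | 0 < e ∧ ∀ y, {i | ‖x.1 i - y‖ < e}.encard < r} := by
  refine exists_continuous_forall_mem_convex_of_local_const (fun x => ?_) fun x => ?_
  · refine Set.OrdConnected.convex ⟨fun a ha b hb c hc => ⟨ha.1.trans_le hc.1, fun y => ?_⟩⟩
    exact (Set.encard_le_encard fun i hi => lt_of_lt_of_le hi hc.2).trans_lt (hb.2 y)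
  -- The factor 4 counts the steps of the chain `x i`, `z i`, `y`, `z j`, `x j`, each shorter than
  -- `e`.
  · obtain ⟨e, he, h⟩ : ∃ e > 0, ∀ i j, ‖x.1 i - x.1 j‖ < 4 * e → x.1 i = x.1 j := by
      have hev : ∀ᶠ e in 𝓝[>] (0 : ℝ), ∀ i j, ‖x.1 i - x.1 j‖ < 4 * e → x.1 i = x.1 j := by
        refine Filter.eventually_all.2 fun i => Filter.eventually_all.2 fun j => ?_
        rcases eq_or_ne (x.1 i) (x.1 j) with hij | hij
        · exact Filter.Eventually.of_forall fun _ _ => hij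
        · have hpos : 0 < ‖x.1 i - x.1 j‖ / 4 := by
            have := norm_pos_iff.2 (sub_ne_zero.2 hij)
            positivity
          filter_upwards [Ioo_mem_nhdsGT hpos] with e he h
          exact absurd h (by linarith [he.2])
      obtain ⟨e, he, he'⟩ := (hev.and self_mem_nhdsWithin).exists
      exact ⟨e, he', he⟩
    refine ⟨e, ?_⟩
    filter_upwards [Metric.ball_mem_nhds x he] with z hz
    refine ⟨he, fun y => encard_lt_of_eq x fun i hi j hj => h i j ?_⟩
    have hz' : ∀ i, ‖x.1 i - z.1 i‖ < e := fun i => by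
      rw [← dist_eq_norm, dist_comm]
      exact (dist_le_pi_dist z.1 x.1 i).trans_lt hz
    have hj' : ‖y - z.1 j‖ < e := by rw [norm_sub_rev]; exact hj
    have hzj : ‖z.1 j - x.1 j‖ < e := by rw [norm_sub_rev]; exact hz' j
    have hi' : ‖z.1 i - y‖ < e := hi
    calc ‖x.1 i - x.1 j‖
        = ‖(x.1 i - z.1 i) + (z.1 i - y) + (y - z.1 j) + (z.1 j - x.1 j)‖ := by congr 1; abel
      _ ≤ ‖x.1 i - z.1 i‖ + ‖z.1 i - y‖ + ‖y - z.1 j‖ + ‖z.1 j - x.1 j‖ := norm_add₄_le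
      _ < 4 * e := by linarith [hz' i]

/-- A continuous positive function on the `r`-configuration space such that balls of this radius
contain fewer than `r` of the points. -/
def separation (r k n : ℕ) : C(RConf r k n, ℝ) := (exists_separation r k n).choose

theorem separation_pos (x : RConf r k n) : 0 < separation r k n x :=
  ((exists_separation r k n).choose_spec x).1

theorem encard_lt_of_separation (x : RConf r k n) (y : E n) :
    {i | ‖x.1 i - y‖ < separation r k n x}.encard < r :=
  ((exists_separation r k n).choose_spec x).2 y

/-! ### The radius on which an immersion is nearly linear -/

instance (m : ℕ) : CompactSpace (Metric.closedBall (0 : E m) (1 / 2)) :=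
  isCompact_iff_compactSpace.1 (isCompact_closedBall _ _)

/-- The inclusion of the closed ball of radius `1/2` into the unit disc. -/
def halfBallInclusion (m : ℕ) : C(Metric.closedBall (0 : E m) (1 / 2), Disc m) where
  toFun x := ⟨x, Metric.closedBall_subset_ball (by norm_num) x.2⟩

/-- The supremum of the norm of the second derivative on the ball of radius `1/2`. -/
def secondDerivBound (g : SmoothMap k m n) (i : Fin k) : ℝ :=
  ‖(g.derivOn i 2).comp (halfBallInclusion m)‖

theorem continuous_secondDerivBound (i : Fin k) :
    Continuous fun g : SmoothMap k m n => secondDerivBound g i := by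
  have h : Continuous fun g : SmoothMap k m n => (g.derivOn i 2).comp (halfBallInclusion m) :=
    (ContinuousMap.continuous_precomp (halfBallInclusion m)).comp (SmoothMap.continuous_derivOn i 2)
  exact (continuous_norm (E := C(Metric.closedBall (0 : E m) (1 / 2), E m [×2]→L[ℝ] E n))).comp h

theorem secondDerivBound_nonneg (g : SmoothMap k m n) (i : Fin k) : 0 ≤ secondDerivBound g i :=
  norm_nonneg ((g.derivOn i 2).comp (halfBallInclusion m))

theorem norm_fderiv_sub_le (g : SmoothMap k m n) (i : Fin k) {x : E m} (hx : ‖x‖ ≤ 1 / 2) :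
    ‖fderiv ℝ (component g i) x - fderiv ℝ (component g i) 0‖ ≤ secondDerivBound g i * ‖x‖ := by
  have hsub : Metric.closedBall (0 : E m) (1 / 2) ⊆ Metric.ball 0 1 :=
    Metric.closedBall_subset_ball (by norm_num)
  have h := (convex_closedBall (0 : E m) (1 / 2)).norm_image_sub_le_of_norm_fderiv_le
    (f := fderiv ℝ (component g i)) (𝕜 := ℝ) (C := secondDerivBound g i) (x := 0) (y := x) ?_ ?_
    (by simp) (by simpa using hx)
  · simpa using h
  · intro y hy
    exact ((g.contDiffAt_component i (hsub hy)).fderiv_right (m := 1) (by norm_cast)).differentiableAt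
      (by simp)
  · intro y hy
    rw [← norm_iteratedFDeriv_one, norm_iteratedFDeriv_fderiv]
    exact ((g.derivOn i 2).comp (halfBallInclusion m)).norm_coe_le_norm ⟨y, hy⟩

/-- The differentials of an immersion at the centres of the discs. -/
def frame (g : Imm k m n) (i : Fin k) : {A : E m →L[ℝ] E n // Function.Injective A} :=
  ⟨fderiv ℝ (component g.1 i) 0, g.2 i (Disc.center m)⟩

theorem continuous_frame (i : Fin k) : Continuous fun g : Imm k m n => frame g i :=
  Continuous.subtype_mk ((SmoothMap.continuous_fderiv i).comp
    (continuous_subtype_val.prodMk (continuous_const (y := Disc.center m)))) _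

/-- The reciprocal of `nearRadius`. -/
def nearRadiusInv (x : RConf r k n) (g : Imm k m n) (i : Fin k) : ℝ :=
  2 + 2 * secondDerivBound g.1 i / injectivityModulus m n (frame g i) +
    (‖(frame g i).1‖ + injectivityModulus m n (frame g i)) / separation r k n x

/-- A radius on which an immersion is close to its differential at the centre, relative to the
separation of a configuration. -/
def nearRadius (x : RConf r k n) (g : Imm k m n) (i : Fin k) : ℝ := (nearRadiusInv x g i)⁻¹

/-- Each summand of `nearRadiusInv` yields one estimate: the half ball stays inside the disc, the
differential varies by at most half its injectivity modulus, and images stay within the separation.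
The summand 2 also makes the last estimate strict. -/
theorem two_le_nearRadiusInv (x : RConf r k n) (g : Imm k m n) (i : Fin k) :
    2 ≤ nearRadiusInv x g i := by
  have h1 := injectivityModulus_pos (frame g i)
  have h2 := separation_pos x
  have h3 : 0 ≤ secondDerivBound g.1 i := secondDerivBound_nonneg _ _
  have h4 : 0 ≤ 2 * secondDerivBound g.1 i / injectivityModulus m n (frame g i) := by positivity
  have h5 : 0 ≤ (‖(frame g i).1‖ + injectivityModulus m n (frame g i)) / separation r k n x := by
    positivity
  unfold nearRadiusInv
  linarith

theorem nearRadius_pos (x : RConf r k n) (g : Imm k m n) (i : Fin k) : 0 < nearRadius x g i :=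
  inv_pos.2 (by linarith [two_le_nearRadiusInv x g i])

theorem nearRadius_le_half (x : RConf r k n) (g : Imm k m n) (i : Fin k) :
    nearRadius x g i ≤ 1 / 2 := by
  rw [nearRadius, one_div]
  exact inv_anti₀ two_pos (two_le_nearRadiusInv x g i)

theorem nearRadius_mul_secondDerivBound_le (x : RConf r k n) (g : Imm k m n) (i : Fin k) :
    secondDerivBound g.1 i * nearRadius x g i ≤ injectivityModulus m n (frame g i) / 2 := by
  have h1 := injectivityModulus_pos (frame g i)
  have h2 := separation_pos x
  have h0 : 0 < nearRadiusInv x g i := by linarith [two_le_nearRadiusInv x g i]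
  have h5 : 0 ≤ (‖(frame g i).1‖ + injectivityModulus m n (frame g i)) / separation r k n x := by
    positivity
  rw [nearRadius, mul_inv_le_iff₀ h0]
  have h6 : 2 * secondDerivBound g.1 i / injectivityModulus m n (frame g i) ≤
      nearRadiusInv x g i := by
    unfold nearRadiusInv
    linarith
  rw [div_le_iff₀ h1] at h6
  linarith

theorem nearRadius_mul_norm_lt (x : RConf r k n) (g : Imm k m n) (i : Fin k) :
    nearRadius x g i * (‖(frame g i).1‖ + injectivityModulus m n (frame g i)) <
      separation r k n x := by
  have h1 := injectivityModulus_pos (frame g i)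
  have h2 := separation_pos x
  have h0 : 0 < nearRadiusInv x g i := by linarith [two_le_nearRadiusInv x g i]
  have h3 : 0 ≤ secondDerivBound g.1 i := secondDerivBound_nonneg _ _
  have h4 : 0 ≤ 2 * secondDerivBound g.1 i / injectivityModulus m n (frame g i) := by positivity
  rw [nearRadius, inv_mul_lt_iff₀ h0]
  have h6 : (‖(frame g i).1‖ + injectivityModulus m n (frame g i)) / separation r k n x <
      nearRadiusInv x g i := by
    unfold nearRadiusInv
    linarith
  rwa [div_lt_iff₀ h2] at h6

theorem continuous_nearRadius {T : Type*} [TopologicalSpace T] {x : T → RConf r k n}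
    {g : T → Imm k m n} (hx : Continuous x) (hg : Continuous g) (i : Fin k) :
    Continuous fun t => nearRadius (x t) (g t) i := by
  have hf : Continuous fun t => frame (g t) i := (continuous_frame i).comp hg
  have hf' : Continuous fun t => ‖(frame (g t) i).1‖ := (continuous_subtype_val.comp hf).norm
  have hc : Continuous fun t => injectivityModulus m n (frame (g t) i) :=
    (injectivityModulus m n).continuous.comp hf
  have hs : Continuous fun t => separation r k n (x t) := (separation r k n).continuous.comp hx
  have hb : Continuous fun t => secondDerivBound (g t).1 i :=
    (continuous_secondDerivBound i).comp (continuous_subtype_val.comp hg)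
  have h1 : Continuous fun t => 2 * secondDerivBound (g t).1 i /
      injectivityModulus m n (frame (g t) i) :=
    (continuous_const.mul hb).div hc fun t => (injectivityModulus_pos _).ne'
  have h2 : Continuous fun t => (‖(frame (g t) i).1‖ + injectivityModulus m n (frame (g t) i)) /
      separation r k n (x t) := (hf'.add hc).div hs fun t => (separation_pos _).ne'
  have h3 : Continuous fun t => nearRadiusInv (x t) (g t) i := (continuous_const.add h1).add h2
  exact h3.inv₀ fun t => by linarith [two_le_nearRadiusInv (x t) (g t) i]

theorem norm_fderiv_sub_frame_le (x : RConf r k n) (g : Imm k m n) (i : Fin k) {p : E m}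
    (hp : ‖p‖ ≤ nearRadius x g i) :
    ‖fderiv ℝ (component g.1 i) p - (frame g i).1‖ ≤ injectivityModulus m n (frame g i) / 2 :=
  (norm_fderiv_sub_le g.1 i (hp.trans (nearRadius_le_half x g i))).trans <|
    (mul_le_mul_of_nonneg_left hp (secondDerivBound_nonneg _ _)).trans
      (nearRadius_mul_secondDerivBound_le x g i)

theorem norm_sub_sub_frame_le (x : RConf r k n) (g : Imm k m n) (i : Fin k) {p q : E m}
    (hp : ‖p‖ ≤ nearRadius x g i) (hq : ‖q‖ ≤ nearRadius x g i) :
    ‖component g.1 i p - component g.1 i q - (frame g i).1 (p - q)‖ ≤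
      injectivityModulus m n (frame g i) / 2 * ‖p - q‖ := by
  refine (convex_closedBall (0 : E m) (nearRadius x g i)).norm_image_sub_le_of_norm_fderiv_le'
    (𝕜 := ℝ) (fun z hz => g.1.differentiableAt_component i ?_)
    (fun z hz => norm_fderiv_sub_frame_le x g i (mem_closedBall_zero_iff.1 hz))
    (mem_closedBall_zero_iff.2 hq) (mem_closedBall_zero_iff.2 hp)
  rw [mem_ball_zero_iff]
  linarith [mem_closedBall_zero_iff.1 hz, nearRadius_le_half x g i]

/-! ### Shrinking the discs and linearising -/

/-- The scale of the contraction, decreasing from `1` to `nearRadius` during the first half. -/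
def contractScale (x : RConf r k n) (g : Imm k m n) (a : I) (i : Fin k) : I :=
  Set.projIcc 0 1 zero_le_one (1 - min (2 * (a : ℝ)) 1 * (1 - nearRadius x g i))

/-- The weight of the differential, increasing from `0` to `1` during the second half. -/
def contractWeight (a : I) : ℝ := max (2 * (a : ℝ) - 1) 0

theorem contractWeight_nonneg (a : I) : 0 ≤ contractWeight a := le_max_right _ _

theorem contractWeight_le_one (a : I) : contractWeight a ≤ 1 :=
  max_le (by linarith [a.2.2]) zero_le_one

theorem contractWeight_of_le {a : I} (ha : (a : ℝ) ≤ 1 / 2) : contractWeight a = 0 :=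
  max_eq_right (by linarith)

theorem contractScale_coe (x : RConf r k n) (g : Imm k m n) (a : I) (i : Fin k) :
    (contractScale x g a i : ℝ) = 1 - min (2 * (a : ℝ)) 1 * (1 - nearRadius x g i) := by
  have h1 : 0 ≤ min (2 * (a : ℝ)) 1 := le_min (by linarith [a.2.1]) zero_le_one
  have h2 : min (2 * (a : ℝ)) 1 ≤ 1 := min_le_right _ _
  have h3 := nearRadius_pos x g i
  have h4 := nearRadius_le_half x g i
  rw [contractScale, Set.projIcc_of_mem _ (⟨by nlinarith, by nlinarith⟩ : _ ∈ Set.Icc (0 : ℝ) 1)]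

theorem contractScale_zero (x : RConf r k n) (g : Imm k m n) (i : Fin k) :
    contractScale x g 0 i = 1 := Subtype.ext (by simp [contractScale_coe])

theorem contractScale_of_ge (x : RConf r k n) (g : Imm k m n) {a : I} (ha : 1 / 2 ≤ (a : ℝ))
    (i : Fin k) : (contractScale x g a i : ℝ) = nearRadius x g i := by
  rw [contractScale_coe, min_eq_right (by linarith)]
  ring

theorem contractScale_pos (x : RConf r k n) (g : Imm k m n) (a : I) (i : Fin k) :
    0 < (contractScale x g a i : ℝ) := by
  have h2 : min (2 * (a : ℝ)) 1 ≤ 1 := min_le_right _ _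
  have h3 := nearRadius_pos x g i
  have h4 := nearRadius_le_half x g i
  rw [contractScale_coe]
  nlinarith

/-- The contraction of an immersion `g` to its differentials at the centres of the discs, with
parameter `a`, translated so that the centres are mapped to `y`. -/
def contractMap (x : RConf r k n) (g : Imm k m n) (a : I) (y : Fin k → E n) : SmoothMap k m n :=
  SmoothMap.deform (fun i => y i - (1 - contractWeight a) • component g.1 i 0)
    (fun _ => 1 - contractWeight a) (contractScale x g a)
    (fun i => (contractWeight a * contractScale x g a i) • (frame g i).1) g.1

theorem contractMap_apply (x : RConf r k n) (g : Imm k m n) (a : I) (y : Fin k → E n)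
    (q : Discs k m) :
    contractMap x g a y q = y q.1 - (1 - contractWeight a) • component g.1 q.1 0 +
      (1 - contractWeight a) • component g.1 q.1 ((contractScale x g a q.1 : ℝ) • (q.2 : E m)) +
      (contractWeight a * contractScale x g a q.1) • (frame g q.1).1 q.2 := rfl

theorem contractMap_center (x : RConf r k n) (g : Imm k m n) (a : I) (y : Fin k → E n)
    (i : Fin k) : contractMap x g a y ⟨i, Disc.center m⟩ = y i := by
  simp [contractMap_apply, Disc.center]

theorem contractMap_zero (x : RConf r k n) (g : Imm k m n) (y : Fin k → E n)
    (hy : ∀ i, g.1 ⟨i, Disc.center m⟩ = y i) : contractMap x g 0 y = g.1 := by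
  ext1
  funext q
  have h : component g.1 q.1 0 = y q.1 := (component_apply _ _ (Disc.center m)).trans (hy _)
  rw [contractMap_apply, contractScale_zero, contractWeight_of_le (by simp), h]
  simp [component_apply]

theorem isImmersion_contractMap (x : RConf r k n) (g : Imm k m n) (a : I) (y : Fin k → E n) :
    (contractMap x g a y).IsImmersion := by
  intro i p
  rw [contractMap, SmoothMap.fderiv_deform p.2]
  have hl := contractScale_pos x g a i
  rcases le_total (a : ℝ) (1 / 2) with ha | ha
  · rw [contractWeight_of_le ha]
    intro v w hvw
    refine g.2 i ⟨_, smul_mem_ball (contractScale x g a i) p.2⟩ ?_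
    simpa [hl.ne'] using hvw
  · have hs := contractScale_of_ge x g ha i
    have hc := injectivityModulus_pos (frame g i)
    have hn : ‖(contractScale x g a i : ℝ) • (p : E m)‖ ≤ nearRadius x g i := by
      rw [norm_smul, Real.norm_of_nonneg hl.le, hs]
      exact mul_le_of_le_one_right (nearRadius_pos x g i).le (mem_ball_zero_iff.1 p.2).le
    have hD := norm_fderiv_sub_frame_le x g i hn
    set D := fderiv ℝ (component g.1 i) ((contractScale x g a i : ℝ) • (p : E m))
    set l : ℝ := (contractScale x g a i : ℝ)
    set u := contractWeight a
    refine (injective_iff_map_eq_zero _).2 fun v hv => ?_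
    -- With `A` the frame and `c` its modulus, a kernel vector of `(1 - u) D + u A` satisfies `A v =
    -- -(1 - u) (D - A) v`, whence `c ‖v‖ ≤ (c / 2) ‖v‖`.
    have hv' : (frame g i).1 v = -((1 - u) • (D - (frame g i).1) v) := by
      have h0 : l • ((1 - u) • D v + u • (frame g i).1 v) = 0 := by
        rw [← hv]
        simp only [add_apply, smul_apply]
        module
      have h1 := (smul_eq_zero.1 h0).resolve_left hl.ne'
      rw [sub_apply, eq_neg_iff_add_eq_zero, ← h1]
      module
    have h2 := injectivityModulus_mul_norm_le (frame g i) v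
    have h3 : ‖(frame g i).1 v‖ ≤ injectivityModulus m n (frame g i) / 2 * ‖v‖ := by
      rw [hv', norm_neg, norm_smul, Real.norm_of_nonneg (by linarith [contractWeight_le_one a])]
      refine (mul_le_of_le_one_left (norm_nonneg _) (by linarith [contractWeight_nonneg a])).trans ?_
      exact ((D - (frame g i).1).le_opNorm v).trans (mul_le_mul_of_nonneg_right hD (norm_nonneg v))
    have h4 : ‖v‖ ≤ 0 := by nlinarith [norm_nonneg v]
    exact norm_le_zero_iff.1 h4

theorem norm_contractMap_sub_sub_le (x : RConf r k n) (g : Imm k m n) {a : I}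
    (ha : 1 / 2 ≤ (a : ℝ)) (y : Fin k → E n) (i : Fin k) (p q : Disc m) :
    ‖contractMap x g a y ⟨i, p⟩ - contractMap x g a y ⟨i, q⟩ -
        nearRadius x g i • (frame g i).1 ((p : E m) - q)‖ ≤
      nearRadius x g i * (injectivityModulus m n (frame g i) / 2 * ‖(p : E m) - q‖) := by
  have hs := contractScale_of_ge x g ha i
  have h0 := nearRadius_pos x g i
  have hn : ∀ p : Disc m, ‖nearRadius x g i • (p : E m)‖ ≤ nearRadius x g i := fun p => by
    rw [norm_smul, Real.norm_of_nonneg h0.le]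
    exact mul_le_of_le_one_right h0.le (mem_ball_zero_iff.1 p.2).le
  have h := norm_sub_sub_frame_le x g i (hn p) (hn q)
  have e : contractMap x g a y ⟨i, p⟩ - contractMap x g a y ⟨i, q⟩ -
        nearRadius x g i • (frame g i).1 ((p : E m) - q) =
      (1 - contractWeight a) • (component g.1 i (nearRadius x g i • (p : E m)) -
        component g.1 i (nearRadius x g i • (q : E m)) -
        (frame g i).1 (nearRadius x g i • (p : E m) - nearRadius x g i • (q : E m))) := by
    simp only [contractMap_apply, hs, map_sub, map_smul]
    module
  rw [e, norm_smul, Real.norm_of_nonneg (by linarith [contractWeight_le_one a])]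
  refine (mul_le_of_le_one_left (norm_nonneg _) (by linarith [contractWeight_nonneg a])).trans
    (h.trans_eq ?_)
  rw [← smul_sub, norm_smul, Real.norm_of_nonneg h0.le]
  ring

/-- Each disc is embedded in the ball of radius `separation` about its centre value. The preimage of
`y` thus injects into the set of centres near `y`, which has fewer than `r` elements. -/
theorem isRImmersion_contractMap_of_ge (x : RConf r k n) (g : Imm k m n) {a : I}
    (ha : 1 / 2 ≤ (a : ℝ)) : (contractMap x g a x.1).IsRImmersion r := by
  refine ⟨isImmersion_contractMap x g a x.1, fun y => ?_⟩
  refine (Set.encard_le_encard_of_injOn (f := Sigma.fst) ?_ ?_).trans_lt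
    (encard_lt_of_separation x y)
  · rintro ⟨i, p⟩ (hp : contractMap x g a x.1 ⟨i, p⟩ = y)
    change ‖x.1 i - y‖ < separation r k n x
    have h := norm_contractMap_sub_sub_le x g ha x.1 i p (Disc.center m)
    have h0 := nearRadius_pos x g i
    have hc := injectivityModulus_pos (frame g i)
    have hp1 : ‖(p : E m)‖ ≤ 1 := (mem_ball_zero_iff.1 p.2).le
    rw [contractMap_center, hp, show ((p : E m) - (Disc.center m : E m)) = p from sub_zero _] at h
    have h1 : ‖nearRadius x g i • (frame g i).1 p‖ ≤
        nearRadius x g i * (‖(frame g i).1‖ * ‖(p : E m)‖) := by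
      rw [norm_smul, Real.norm_of_nonneg h0.le]
      exact mul_le_mul_of_nonneg_left ((frame g i).1.le_opNorm p) h0.le
    have h2 : ‖y - x.1 i‖ ≤ ‖y - x.1 i - nearRadius x g i • (frame g i).1 p‖ +
        ‖nearRadius x g i • (frame g i).1 p‖ := by
      simpa using norm_add_le (y - x.1 i - nearRadius x g i • (frame g i).1 p)
        (nearRadius x g i • (frame g i).1 p)
    rw [norm_sub_rev]
    refine lt_of_le_of_lt ?_ (nearRadius_mul_norm_lt x g i)
    calc ‖y - x.1 i‖
        ≤ nearRadius x g i * (injectivityModulus m n (frame g i) / 2 * ‖(p : E m)‖) +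
          nearRadius x g i * (‖(frame g i).1‖ * ‖(p : E m)‖) := by linarith
      _ = nearRadius x g i * (injectivityModulus m n (frame g i) / 2 + ‖(frame g i).1‖) *
          ‖(p : E m)‖ := by ring
      _ ≤ nearRadius x g i * (injectivityModulus m n (frame g i) / 2 + ‖(frame g i).1‖) :=
          mul_le_of_le_one_right (by positivity) hp1
      _ ≤ _ := mul_le_mul_of_nonneg_left (by linarith) h0.le
  · rintro ⟨i, p⟩ (hp : contractMap x g a x.1 ⟨i, p⟩ = y) ⟨j, q⟩
      (hq : contractMap x g a x.1 ⟨j, q⟩ = y) (hij : i = j)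
    subst hij
    have h := norm_contractMap_sub_sub_le x g ha x.1 i p q
    have h0 := nearRadius_pos x g i
    have hc := injectivityModulus_pos (frame g i)
    have h1 := injectivityModulus_mul_norm_le (frame g i) ((p : E m) - q)
    rw [hp, hq, sub_self, zero_sub, norm_neg, norm_smul, Real.norm_of_nonneg h0.le] at h
    have h2 := le_of_mul_le_mul_left h h0
    have h3 : ‖(p : E m) - q‖ ≤ 0 := by nlinarith [norm_nonneg ((p : E m) - q)]
    rw [Subtype.ext (sub_eq_zero.1 (norm_le_zero_iff.1 h3))]

theorem isRImmersion_contractMap_of_isRImmersion (x : RConf r k n) (g : Imm k m n) (a : I)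
    (hg : g.1.IsRImmersion r) (hx : ∀ i, g.1 ⟨i, Disc.center m⟩ = x.1 i) :
    (contractMap x g a x.1).IsRImmersion r := by
  rcases le_total (1 / 2) (a : ℝ) with ha | ha
  · exact isRImmersion_contractMap_of_ge x g ha
  refine ⟨isImmersion_contractMap x g a x.1, fun y => ?_⟩
  -- In the first half the map is `g` after an injective rescaling of each disc, the translation
  -- being trivial because `g` already has centre values `x`.
  refine (Set.encard_le_encard_of_injOn
    (f := fun q : Discs k m => ⟨q.1, ⟨_, smul_mem_ball (contractScale x g a q.1) q.2.2⟩⟩)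
    ?_ ?_).trans_lt (hg.2 y)
  · rintro ⟨i, p⟩ (hp : contractMap x g a x.1 ⟨i, p⟩ = y)
    have h : component g.1 i 0 = x.1 i := (component_apply _ _ (Disc.center m)).trans (hx _)
    change g.1 ⟨i, ⟨_, smul_mem_ball (contractScale x g a i) p.2⟩⟩ = y
    rw [← component_apply g.1 i ⟨_, smul_mem_ball (contractScale x g a i) p.2⟩, ← hp,
      contractMap_apply, contractWeight_of_le ha, h]
    simp
  · rintro ⟨i, p⟩ - ⟨j, q⟩ - hpq
    obtain ⟨hij, hpq⟩ := Sigma.mk.inj_iff.1 hpq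
    change i = j at hij
    subst hij
    have h : (contractScale x g a i : ℝ) • (p : E m) = (contractScale x g a i : ℝ) • (q : E m) :=
      congrArg Subtype.val (eq_of_heq hpq)
    rw [Subtype.ext (smul_right_injective _ (contractScale_pos x g a i).ne' h)]

theorem continuous_contractScale {T : Type*} [TopologicalSpace T] {x : T → RConf r k n}
    {g : T → Imm k m n} {a : T → I} (hx : Continuous x) (hg : Continuous g) (ha : Continuous a)
    (i : Fin k) : Continuous fun t => contractScale (x t) (g t) (a t) i := by
  have hn : Continuous fun t => nearRadius (x t) (g t) i :=
    continuous_nearRadius hx hg i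
  have ha' : Continuous fun t => (a t : ℝ) := continuous_subtype_val.comp ha
  have h : Continuous fun t => 1 - min (2 * (a t : ℝ)) 1 * (1 - nearRadius (x t) (g t) i) := by
    fun_prop
  exact continuous_projIcc.comp h

theorem continuous_contractMap {T : Type*} [TopologicalSpace T] {x : T → RConf r k n}
    {g : T → Imm k m n} {a : T → I} {y : T → Fin k → E n} (hx : Continuous x) (hg : Continuous g)
    (ha : Continuous a) (hy : Continuous y) :
    Continuous fun t => contractMap (x t) (g t) (a t) (y t) := by
  have hu : Continuous fun t => contractWeight (a t) :=
    ((continuous_const.mul (continuous_subtype_val.comp ha)).sub continuous_const).max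
      continuous_const
  have hl := continuous_contractScale hx hg ha
  have hg' : Continuous fun t => (g t).1 := continuous_subtype_val.comp hg
  refine SmoothMap.continuous_deform (continuous_pi fun i => ?_)
    (continuous_pi fun i => continuous_const.sub hu) (continuous_pi hl)
    (continuous_pi fun i => ?_) hg'
  · refine ((continuous_apply i).comp hy).sub ((continuous_const.sub hu).smul ?_)
    exact ((SmoothMap.continuous_eval ⟨i, Disc.center m⟩).comp hg').congr fun t =>
      (component_apply _ _ (Disc.center m)).symm
  · exact (hu.mul (continuous_subtype_val.comp (hl i))).smul
      (continuous_subtype_val.comp ((continuous_frame i).comp hg))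

end Contract

/-! ### The vertical contraction of the homotopy fibre -/

section Fiber

variable {r k m n : ℕ}

/-- The values of an immersion at the centres of the discs. -/
def centers (g : Imm k m n) (i : Fin k) : E n := g.1 ⟨i, Disc.center m⟩

theorem continuous_centers : Continuous (centers (k := k) (m := m) (n := n)) :=
  continuous_pi fun _ => (SmoothMap.continuous_eval _).comp continuous_subtype_val

/-- The time at which a path of immersions is evaluated in `contractFamily`. -/
def familyTime (s t : I) : I := Set.projIcc 0 1 zero_le_one (max (t : ℝ) (2 * s - 1))

/-- The contraction parameter in `contractFamily`. -/
def familyParam (s t : I) : I := Set.projIcc 0 1 zero_le_one (min (2 * (s : ℝ)) 1 * (1 - t))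

/-- The values at the centres of the discs in `contractFamily`. -/
def familyCenters (x : RConf r k n) (γ : C(I, Imm k m n)) (b : Imm k m n) (s t : I) :
    Fin k → E n :=
  (1 - (s : ℝ)) • centers (γ t) + (s : ℝ) • ((1 - (t : ℝ)) • x.1 + (t : ℝ) • centers b)

/-- On the edge `t = 0` the two parameters move in turn: for `s ≤ 1/2` the time stays 0 while the
contraction runs from 0 to 1; afterwards the contraction is complete and the time runs along `γ`. -/
theorem familyTime_zero_left (t : I) : familyTime 0 t = t := by
  have h : max (t : ℝ) (2 * ((0 : I) : ℝ) - 1) = t :=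
    max_eq_left (by have := t.2.1; simp only [Set.Icc.coe_zero]; linarith)
  rw [familyTime, h, Set.projIcc_val]

theorem familyTime_one_left (t : I) : familyTime 1 t = 1 :=
  Set.projIcc_of_right_le _ (le_max_of_le_right (by norm_num))

theorem familyTime_one_right (s : I) : familyTime s 1 = 1 :=
  Set.projIcc_of_right_le _ (le_max_of_le_left (by simp))

theorem familyTime_zero_right {s : I} (hs : (s : ℝ) ≤ 1 / 2) : familyTime s 0 = 0 :=
  Set.projIcc_of_le_left _ (max_le (by simp) (by linarith))

theorem familyParam_zero_left (t : I) : familyParam 0 t = 0 :=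
  Set.projIcc_of_le_left _ (by simp)

theorem familyParam_one_right (s : I) : familyParam s 1 = 0 :=
  Set.projIcc_of_le_left _ (by simp)

theorem familyParam_zero_right {s : I} (hs : 1 / 2 ≤ (s : ℝ)) : familyParam s 0 = 1 :=
  Set.projIcc_of_right_le _ (by
    rw [min_eq_right (by linarith)]
    simp)

/-- A two-parameter family of immersions starting at a path `γ` for `s = 0`, ending at `b` for
`t = 1`, and independent of `γ` for `s = 1`. -/
def contractFamily (x : RConf r k n) (γ : C(I, Imm k m n)) (b : Imm k m n) (s t : I) :
    Imm k m n :=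
  ⟨contractMap x (γ (familyTime s t)) (familyParam s t) (familyCenters x γ b s t),
    isImmersion_contractMap _ _ _ _⟩

theorem continuous_contractFamily {T : Type*} [TopologicalSpace T] {x : T → RConf r k n}
    {γ : T → C(I, Imm k m n)} {b : Imm k m n} {s t : T → I} (hx : Continuous x) (hγ : Continuous γ)
    (hs : Continuous s) (ht : Continuous t) :
    Continuous fun q => contractFamily (x q) (γ q) b (s q) (t q) := by
  have hs' : Continuous fun q => (s q : ℝ) := continuous_subtype_val.comp hs
  have ht' : Continuous fun q => (t q : ℝ) := continuous_subtype_val.comp ht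
  have hx' : Continuous fun q => (x q).1 := continuous_subtype_val.comp hx
  have h1 : Continuous fun q => max (t q : ℝ) (2 * s q - 1) := by fun_prop
  have h2 : Continuous fun q => min (2 * (s q : ℝ)) 1 * (1 - t q) := by fun_prop
  have hT : Continuous fun q => familyTime (s q) (t q) := continuous_projIcc.comp h1
  have hP : Continuous fun q => familyParam (s q) (t q) := continuous_projIcc.comp h2
  have hγt : Continuous fun q => centers (γ q (t q)) := continuous_centers.comp (hγ.eval ht)
  have hC : Continuous fun q => familyCenters (x q) (γ q) b (s q) (t q) :=
    ((continuous_const.sub hs').smul hγt).add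
      (hs'.smul (((continuous_const.sub ht').smul hx').add (ht'.smul continuous_const)))
  exact Continuous.subtype_mk (continuous_contractMap hx (hγ.eval hT) hP hC) _

theorem contractFamily_zero_left (x : RConf r k n) (γ : C(I, Imm k m n)) (b : Imm k m n) (t : I) :
    contractFamily x γ b 0 t = γ t := by
  refine Subtype.ext ?_
  simp only [contractFamily, familyTime_zero_left, familyParam_zero_left]
  exact contractMap_zero _ _ _ fun i => by simp [familyCenters, centers]

theorem contractFamily_one_left (x : RConf r k n) (γ γ' : C(I, Imm k m n)) (b : Imm k m n) (t : I)
    (h : γ 1 = γ' 1) : contractFamily x γ b 1 t = contractFamily x γ' b 1 t := by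
  simp [contractFamily, familyTime_one_left, familyCenters, h]

theorem contractFamily_one_right (x : RConf r k n) {γ : C(I, Imm k m n)} {b : Imm k m n} (s : I)
    (h : γ 1 = b) : contractFamily x γ b s 1 = b := by
  refine Subtype.ext ?_
  simp only [contractFamily, familyTime_one_right, familyParam_one_right, h]
  refine contractMap_zero _ _ _ fun i => ?_
  simp only [familyCenters, h, Set.Icc.coe_one, sub_self, zero_smul, zero_add, one_smul,
    ← add_smul, sub_add_cancel]
  rfl

theorem centers_contractFamily (x : RConf r k n) (γ : C(I, Imm k m n)) (b : Imm k m n) (s t : I) :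
    centers (contractFamily x γ b s t) = familyCenters x γ b s t :=
  funext fun _ => contractMap_center _ _ _ _ _

theorem familyCenters_zero_right (x : RConf r k n) (γ : C(I, Imm k m n)) (b : Imm k m n) (s : I)
    (h : s = 1 ∨ centers (γ 0) = x.1) : familyCenters x γ b s 0 = x.1 := by
  rcases h with rfl | h
  · simp [familyCenters]
  · simp [familyCenters, h, ← add_smul]

/-- While `s ≤ 1/2` only `γ 0`, an `r`-immersion, is contracted. Later `γ` passes through arbitrary
immersions, but the contraction is then complete and its result is an `r`-immersion regardless. -/
theorem isRImmersion_contractFamily (x : RConf r k n) (γ : C(I, Imm k m n)) (b : Imm k m n) (s : I)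
    (h : s = 1 ∨ (γ 0).1.IsRImmersion r ∧ centers (γ 0) = x.1) :
    (contractFamily x γ b s 0).1.IsRImmersion r := by
  have hc := familyCenters_zero_right x γ b s (h.imp_right And.right)
  simp only [contractFamily, hc]
  rcases le_total (1 / 2) (s : ℝ) with hs | hs
  · rw [familyParam_zero_right hs]
    exact isRImmersion_contractMap_of_ge _ _ (by norm_num)
  · obtain ⟨hr, hx⟩ := h.resolve_left (by rintro rfl; norm_num at hs)
    rw [familyTime_zero_right hs]
    exact isRImmersion_contractMap_of_isRImmersion _ _ _ hr fun i => congrFun hx i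

/-- The path `contractFamily x γ b s` as a point of the homotopy fibre. -/
def contractFiber (x : RConf r k n) (γ : C(I, Imm k m n)) (b : Imm k m n) (s : I) (h1 : γ 1 = b)
    (h : s = 1 ∨ (γ 0).1.IsRImmersion r ∧ centers (γ 0) = x.1) :
    HomotopyFiber (rImmToImm r k m n) b :=
  ⟨(⟨(contractFamily x γ b s 0).1, isRImmersion_contractFamily x γ b s h⟩,
    ⟨fun t => contractFamily x γ b s t, continuous_contractFamily continuous_const continuous_const
      continuous_const continuous_id⟩), rfl, contractFamily_one_right x s h1⟩

theorem continuous_contractFiber {T : Type*} [TopologicalSpace T] {x : T → RConf r k n}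
    {γ : T → C(I, Imm k m n)} {b : Imm k m n} {s : T → I} (hx : Continuous x) (hγ : Continuous γ)
    (hs : Continuous s) (h1 : ∀ q, γ q 1 = b)
    (h : ∀ q, s q = 1 ∨ (γ q 0).1.IsRImmersion r ∧ centers (γ q 0) = (x q).1) :
    Continuous fun q => contractFiber (x q) (γ q) b (s q) (h1 q) (h q) := by
  refine Continuous.subtype_mk (Continuous.prodMk (Continuous.subtype_mk ?_ _) ?_) _
  · exact continuous_subtype_val.comp (continuous_contractFamily hx hγ hs continuous_const)
  · exact ContinuousMap.continuous_of_continuous_uncurry _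
      (continuous_contractFamily (hx.comp continuous_fst) (hγ.comp continuous_fst)
        (hs.comp continuous_fst) continuous_snd)

theorem evalCenters_contractFiber (x : RConf r k n) (γ : C(I, Imm k m n)) (b : Imm k m n) (s : I)
    (h1 : γ 1 = b) (h : s = 1 ∨ (γ 0).1.IsRImmersion r ∧ centers (γ 0) = x.1) :
    evalCenters r k m n (HomotopyFiber.proj (rImmToImm r k m n) b (contractFiber x γ b s h1 h)) =
      x :=
  Subtype.ext ((centers_contractFamily x γ b s 0).trans
    (familyCenters_zero_right x γ b s (h.imp_right And.right)))

theorem isRImmersion_and_centers {b : Imm k m n} (z : HomotopyFiber (rImmToImm r k m n) b) :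
    (z.1.2 0).1.IsRImmersion r ∧ centers (z.1.2 0) = (evalCenters r k m n z.1.1).1 := by
  rw [z.2.1]
  exact ⟨z.1.1.2, rfl⟩

/-- The map from the homotopy fibre to the `r`-configuration space. -/
def fiberEval (r : ℕ) (b : Imm k m n) : C(HomotopyFiber (rImmToImm r k m n) b, RConf r k n) :=
  (evalCenters r k m n).comp (HomotopyFiber.proj (rImmToImm r k m n) b)

/-- A section of `fiberEval`, given by small multiples of the differentials of `b`. -/
def fiberSection (r : ℕ) (b : Imm k m n) :
    C(RConf r k n, HomotopyFiber (rImmToImm r k m n) b) where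
  toFun x := contractFiber x (ContinuousMap.const I b) b 1 rfl (Or.inl rfl)
  continuous_toFun := continuous_contractFiber continuous_id continuous_const continuous_const
    (fun _ => rfl) fun _ => Or.inl rfl

/-- The vertical homotopy from the identity to `fiberSection ∘ fiberEval`. -/
def fiberHomotopy (r : ℕ) (b : Imm k m n) :
    C(HomotopyFiber (rImmToImm r k m n) b × I, HomotopyFiber (rImmToImm r k m n) b) where
  toFun q := contractFiber (fiberEval r b q.1) q.1.1.2 b q.2 q.1.2.2
    (Or.inr (isRImmersion_and_centers q.1))
  continuous_toFun := continuous_contractFiber ((fiberEval r b).continuous.comp continuous_fst)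
    ((continuous_snd.comp continuous_subtype_val).comp continuous_fst) continuous_snd
    (fun q => q.1.2.2) fun q => Or.inr (isRImmersion_and_centers q.1)

theorem fiberHomotopy_zero (b : Imm k m n) (z : HomotopyFiber (rImmToImm r k m n) b) :
    fiberHomotopy r b (z, 0) = z := by
  have h : ∀ t, contractFamily (fiberEval r b z) z.1.2 b 0 t = z.1.2 t :=
    contractFamily_zero_left _ _ _
  have h0 : (contractFamily (fiberEval r b z) z.1.2 b 0 0).1 = z.1.1.1 :=
    congrArg Subtype.val ((h 0).trans z.2.1)
  exact Subtype.ext (Prod.ext (Subtype.ext h0) (ContinuousMap.ext h))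

theorem fiberHomotopy_one (b : Imm k m n) (z : HomotopyFiber (rImmToImm r k m n) b) :
    fiberHomotopy r b (z, 1) = fiberSection r b (fiberEval r b z) := by
  have h : ∀ t, contractFamily (fiberEval r b z) z.1.2 b 1 t =
      contractFamily (fiberEval r b z) (ContinuousMap.const I b) b 1 t :=
    fun t => contractFamily_one_left _ _ _ _ _ z.2.2
  have h0 : (contractFamily (fiberEval r b z) z.1.2 b 1 0).1 =
      (contractFamily (fiberEval r b z) (ContinuousMap.const I b) b 1 0).1 :=
    congrArg Subtype.val (h 0)
  exact Subtype.ext (Prod.ext (Subtype.ext h0) (ContinuousMap.ext h))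

theorem isWeakHomotopyEquiv_fiberEval (r : ℕ) (b : Imm k m n) :
    IsWeakHomotopyEquiv (fiberEval r b) :=
  isWeakHomotopyEquiv_of_vertical_homotopy _ (fiberSection r b) (fiberHomotopy r b)
    (fun x => evalCenters_contractFiber x (ContinuousMap.const I b) b 1 rfl (Or.inl rfl))
    (fiberHomotopy_zero b) (fiberHomotopy_one b)
    fun z t => evalCenters_contractFiber (fiberEval r b z) z.1.2 b t z.2.2
      (Or.inr (isRImmersion_and_centers z))

end Fiber

end RImmersion

end

theorem mainTheorem2 (r k m n : ℕ) (hr : 2 ≤ r) (b : RImmersion.Imm k m n) :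
    RImmersion.IsWeakHomotopyEquiv
      ((RImmersion.evalCenters r k m n).comp
        (RImmersion.HomotopyFiber.proj (RImmersion.rImmToImm r k m n) b)) :=
  RImmersion.isWeakHomotopyEquiv_fiberEval r b
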